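/- Let $N\ge 1$, $1<p<\infty$, $p'=p/(p-1)$, $m>p'$ and $\chi,M>0$. For $0<s<N/2$ let $$K_s(x)=c_{N,s}\,|x|^{2s-N},\qquad c_{N,s}=\pi^{-N/2}\,2^{-2s}\,\frac{\Gamma(N/2-s)}{\Gamma(s)},$$ be the Riesz kernel on $\mathbb R^N$, and let $$\mathcal Y_M=\Big\{\rho\in L^1(\mathbb R^N)\cap L^m(\mathbb R^N):\ \rho\ge 0\ \text{a.e.},\ x\rho\in L^1(\mathbb R^N),\ \int_{\mathbb R^N}x\,\rho(x)\,dx=0,\ \int_{\mathbb R^N}\rho\,dx=M\Big\}.$$ For $\rho\in\mathcal Y_M$ and $0<s<N/p$ define $$\mathcal F_{s,p}(\rho)=\frac1{m-1}\int_{\mathbb R^N}\rho^m\,dx-\frac{\chi}{p'}\int_{\mathbb R^N}(K_{s/2}*\rho)^{p'}\,dx,\qquad \mathcal F_0(\rho)=\frac1{m-1}\int_{\mathbb R^N}\rho^m\,dx-\frac{\chi}{p'}\int_{\mathbb R^N}\rho^{p'}\,dx.$$ Then, as $s\to0$, $\mathcal F_{s,p}$ $\Gamma$-converges to $\mathcal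 F_0$ on $\mathcal Y_M$ with respect to strong convergence in $L^{p'}(\mathbb R^N)$. That is, for every sequence $(s_k)\subset(0,N/p)$ with $s_k\to0$ and every $\rho\in\mathcal Y_M$: (i) for every sequence $(\rho_k)\subset\mathcal Y_M$ with $\|\rho_k-\rho\|_{L^{p'}}\to0$ one has $\mathcal F_0(\rho)\le\liminf_{k\to\infty}\mathcal F_{s_k,p}(\rho_k)$; (ii) there is a sequence $(\rho_k)\subset\mathcal Y_M$ with $\|\rho_k-\rho\|_{L^{p'}}\to0$ and $\limsup_{k\to\infty}\mathcal F_{s_k,p}(\rho_k)\le\mathcal F_0(\rho)$. -/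

import Mathlib

open MeasureTheory Filter Topology

noncomputable section

/-- Euclidean space `ℝ^N`. -/
abbrev RN (N : ℕ) : Type := EuclideanSpace ℝ (Fin N)

/-- The normalising constant `c_{N,s} = π^{-N/2} 2^{-2s} Γ(N/2 - s) / Γ(s)`. -/
def rieszConst (N : ℕ) (s : ℝ) : ℝ :=
  Real.pi ^ (-((N : ℝ) / 2)) * (2 : ℝ) ^ (-(2 * s)) *
    (Real.Gamma ((N : ℝ) / 2 - s) / Real.Gamma s)

/-- The Riesz kernel `K_s(x) = c_{N,s} |x|^{2s-N}`, for `0 < s < N/2`. -/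
def rieszKernel (N : ℕ) (s : ℝ) (x : RN N) : ℝ :=
  rieszConst N s * ‖x‖ ^ (2 * s - (N : ℝ))

/-- The Riesz potential `(K_s ∗ ρ)(x) = ∫ K_s(x - y) ρ(y) dy` of a nonnegative function `ρ`,
with values in `[0, ∞]`. -/
def rieszPotential (N : ℕ) (s : ℝ) (ρ : RN N → ℝ) (x : RN N) : ENNReal :=
  ∫⁻ y, ENNReal.ofReal (rieszKernel N s (x - y)) * ENNReal.ofReal (ρ y)

/-- The class `𝒴_M` of nonnegative densities in `L¹ ∩ L^m` with mass `M` and (well-defined)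
centre of mass at the origin. -/
def densityClass (N : ℕ) (m M : ℝ) : Set (RN N → ℝ) :=
  {ρ | MemLp ρ 1 volume ∧ MemLp ρ (ENNReal.ofReal m) volume ∧
    (∀ᵐ x ∂(volume : Measure (RN N)), 0 ≤ ρ x) ∧
    Integrable (fun x => ρ x • x) volume ∧ (∫ x, ρ x • x) = 0 ∧
    (∫ x, ρ x) = M}

/-- `∫ ρ^r dx` for a nonnegative function `ρ`, with values in `[0, ∞]`. -/
def powerIntegral (N : ℕ) (r : ℝ) (ρ : RN N → ℝ) : ENNReal :=
  ∫⁻ x, ENNReal.ofReal (ρ x) ^ r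

/-- The free energy
`F_{s,p}(ρ) = 1/(m-1) ∫ ρ^m - (χ/p') ∫ (K_{s/2} ∗ ρ)^{p'}`, as an extended real number. The
first term is finite on `𝒴_M`, so that no difference `∞ - ∞` occurs there. -/
def freeEnergy (N : ℕ) (p m χ s : ℝ) (ρ : RN N → ℝ) : EReal :=
  ((ENNReal.ofReal (1 / (m - 1)) * powerIntegral N m ρ : ENNReal) : EReal) -
    ((ENNReal.ofReal (χ / p.conjExponent) *
      ∫⁻ x, rieszPotential N (s / 2) ρ x ^ p.conjExponent : ENNReal) : EReal)

/-- The limit functional `F_0(ρ) = 1/(m-1) ∫ ρ^m - (χ/p') ∫ ρ^{p'}`. -/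
def limitEnergy (N : ℕ) (p m χ : ℝ) (ρ : RN N → ℝ) : EReal :=
  ((ENNReal.ofReal (1 / (m - 1)) * powerIntegral N m ρ : ENNReal) : EReal) -
    ((ENNReal.ofReal (χ / p.conjExponent) *
      powerIntegral N p.conjExponent ρ : ENNReal) : EReal)

/-- Strong convergence in `L^r(ℝ^N)` of a sequence of functions. -/
def StrongLpConv (N : ℕ) (r : ℝ) (u : ℕ → RN N → ℝ) (v : RN N → ℝ) : Prop :=
  Tendsto (fun k => eLpNorm (fun x => u k x - v x) (ENNReal.ofReal r) volume) atTop (𝓝 0)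

/-- `Γ`-convergence on the set `Y`, with respect to a notion `conv` of convergence of sequences,
of a sequence of functionals `F k` to `F₀`: the liminf inequality along every sequence in `Y`
that converges to a point of `Y`, and a recovery sequence in `Y` for every point of `Y`. -/
structure GammaConvergesOn {X : Type*} (conv : (ℕ → X) → X → Prop) (Y : Set X)
    (F : ℕ → X → EReal) (F₀ : X → EReal) : Prop where
  liminf_le : ∀ x ∈ Y, ∀ u : ℕ → X, (∀ k, u k ∈ Y) → conv u x →
    F₀ x ≤ liminf (fun k => F k (u k)) atTop
  recovery : ∀ x ∈ Y, ∃ u : ℕ → X, (∀ k, u k ∈ Y) ∧ conv u x ∧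
    limsup (fun k => F k (u k)) atTop ≤ F₀ x

end

/-!
Write `q = p' > 1`. As `s → 0` the Riesz kernel `K_{s/2}` is an approximate identity with a small
tail. By polar coordinates its mass in a ball of radius `r` is `c_{N,s/2} N |B_1| r^s / s`, which
tends to `1` (`tendsto_lintegral_ball_rieszKernel`); outside the unit ball its `L^q` norm is bounded
by `c_{N,s/2}` times a constant, and tends to `0` (`tendsto_eLpNorm'_rieszKernel_compl_ball`). This
is why no Hardy–Littlewood–Sobolev inequality is needed.

For the liminf inequality, Young's inequality (`eLpNorm'_lconvolution_le`) applied to the two parts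
of the kernel bounds `‖K_{s/2} ∗ ρ_k‖_q` by `(1 + o(1)) ‖ρ_k‖_q + o(1) M`, hence the interaction term
is asymptotically at most `∫ ρ^q` (`exists_tendsto_lintegral_rieszPotential_le`), while `∫ ρ^m` is
lower semicontinuous by Fatou's lemma (`powerIntegral_le_liminf`).

The constant sequence is a recovery sequence: it suffices that `∫ ρ^q` is at most the lower limit of
`∫ (K_{s/2} ∗ ρ)^q` (`powerIntegral_le_liminf_rieszPotential`). For a continuous function in place
of `ρ` this follows from a pointwise lower bound for the truncated potentials and Fatou's lemma
(`eLpNorm'_le_liminf_lconvolution_of_continuous`), and Young's inequality carries it over to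
`ρ ∈ L^q` by density.
-/

/-! ### Young's inequality for convolutions of nonnegative functions -/

/-- Jensen's inequality for the measure with density `k`, of arbitrary total mass. -/
theorem rpow_lintegral_mul_le {α : Type*} [MeasurableSpace α] {μ : Measure α} {q : ℝ}
    (hq : 1 < q) {k g : α → ENNReal} (hk : AEMeasurable k μ) (hg : AEMeasurable g μ) :
    (∫⁻ x, k x * g x ∂μ) ^ q ≤ (∫⁻ x, k x ∂μ) ^ (q - 1) * ∫⁻ x, k x * g x ^ q ∂μ := by
  have hpq : q.HolderConjugate q.conjExponent := Real.HolderConjugate.conjExponent hq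
  have hq0 : 0 < q := hpq.pos
  have hq'0 : 0 < q.conjExponent := hpq.symm.pos
  have hsplit : ∀ x, k x * g x = (k x ^ (1 / q) * g x) * k x ^ (1 / q.conjExponent) := fun x => by
    rw [mul_right_comm, ← ENNReal.rpow_add_of_nonneg _ _ (by positivity) (by positivity)]
    simp [hpq.inv_add_inv_eq_one]
  have hH := ENNReal.lintegral_mul_le_Lp_mul_Lq μ hpq
    ((hk.pow_const (1 / q)).mul hg) (hk.pow_const (1 / q.conjExponent))
  simp only [Pi.mul_apply] at hH
  simp_rw [hsplit]
  refine (ENNReal.rpow_le_rpow hH hq0.le).trans (le_of_eq ?_)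
  rw [ENNReal.mul_rpow_of_nonneg _ _ hq0.le, ← ENNReal.rpow_mul, ← ENNReal.rpow_mul,
    one_div_mul_cancel hq0.ne', ENNReal.rpow_one, mul_comm]
  have hexp : 1 / q.conjExponent * q = q - 1 := by
    have := hpq.inv_add_inv_eq_one
    field_simp at this ⊢
    linarith
  rw [hexp]
  congr 1
  · congr 1
    refine lintegral_congr fun x => ?_
    rw [← ENNReal.rpow_mul, one_div_mul_cancel hq'0.ne', ENNReal.rpow_one]
  · refine lintegral_congr fun x => ?_
    rw [ENNReal.mul_rpow_of_nonneg _ _ hq0.le, ← ENNReal.rpow_mul,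
      one_div_mul_cancel hq0.ne', ENNReal.rpow_one]

/-- Young's inequality `‖k ∗ g‖_q ≤ ‖k‖_1 ‖g‖_q`. As the convolution is commutative, it serves both
for an integrable kernel acting on `g ∈ L^q` and for a kernel in `L^q` acting on an integrable
density. -/
theorem eLpNorm'_lconvolution_le {G : Type*} [AddCommGroup G] [MeasurableSpace G]
    [MeasurableAdd₂ G] [MeasurableNeg G] {μ : Measure G} [μ.IsAddLeftInvariant] [SFinite μ]
    {q : ℝ} (hq : 1 < q) {k g : G → ENNReal} (hk : Measurable k) (hg : Measurable g) :
    eLpNorm' (k ⋆ₗ[μ] g) q μ ≤ (∫⁻ x, k x ∂μ) * eLpNorm' g q μ := by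
  have hq0 : 0 < q := by linarith
  simp only [eLpNorm', enorm_eq_self]
  have key : ∫⁻ x, (k ⋆ₗ[μ] g) x ^ q ∂μ ≤ (∫⁻ x, k x ∂μ) ^ q * ∫⁻ x, g x ^ q ∂μ := calc
    _ ≤ ∫⁻ x, (∫⁻ y, k y ∂μ) ^ (q - 1) * ∫⁻ y, k y * g (-y + x) ^ q ∂μ ∂μ :=
      lintegral_mono fun x => rpow_lintegral_mul_le hq (by fun_prop) (by fun_prop)
    _ = (∫⁻ y, k y ∂μ) ^ (q - 1) * ∫⁻ y, ∫⁻ x, k y * g (-y + x) ^ q ∂μ ∂μ := by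
      rw [lintegral_const_mul _ (by fun_prop), lintegral_lintegral_swap (by fun_prop)]
    _ = (∫⁻ y, k y ∂μ) ^ (q - 1) * ((∫⁻ y, k y ∂μ) * ∫⁻ x, g x ^ q ∂μ) := by
      congr 1
      rw [← lintegral_mul_const _ hk]
      refine lintegral_congr fun y => ?_
      rw [lintegral_const_mul _ (by fun_prop),
        lintegral_add_left_eq_self (fun x => g x ^ q) (-y)]
    _ = _ := by
      rw [← mul_assoc]
      congr 1
      nth_rw 2 [← ENNReal.rpow_one (∫⁻ y, k y ∂μ)]
      rw [← ENNReal.rpow_add_of_nonneg _ _ (by linarith) zero_le_one]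
      congr 1
      ring
  calc _ ≤ ((∫⁻ x, k x ∂μ) ^ q * ∫⁻ x, g x ^ q ∂μ) ^ (1 / q) := by gcongr
    _ = _ := by
      rw [ENNReal.mul_rpow_of_nonneg _ _ (by positivity), ← ENNReal.rpow_mul,
        mul_one_div_cancel hq0.ne', ENNReal.rpow_one]

/-! ### The Riesz kernel near the origin and at infinity -/

section Riesz

variable {N : ℕ}

theorem measurable_ofReal_rieszKernel (s : ℝ) :
    Measurable fun x : RN N => ENNReal.ofReal (rieszKernel N s x) := by
  unfold rieszKernel; fun_prop

theorem rieszConst_nonneg {s : ℝ} (hs : 0 < s) (hsN : 2 * s < N) : 0 ≤ rieszConst N s := by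
  unfold rieszConst
  have := Real.Gamma_pos_of_pos hs
  have := Real.Gamma_pos_of_pos (s := (N : ℝ) / 2 - s) (by linarith)
  positivity

/-- The mass of `K_{s/2}` in a ball around the origin, in polar coordinates. -/
theorem lintegral_ball_rieszKernel (hN : 1 ≤ N) {s r : ℝ} (hs : 0 < s) (hsN : s < N)
    (hr : 0 < r) :
    ∫⁻ x in Metric.ball (0 : RN N) r, ENNReal.ofReal (rieszKernel N (s / 2) x) =
      ENNReal.ofReal
        (rieszConst N (s / 2) / s * (N * volume.real (Metric.ball (0 : RN N) 1)) * r ^ s) := by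
  have : Nonempty (Fin N) := ⟨⟨0, hN⟩⟩
  have hc : 0 ≤ rieszConst N (s / 2) := rieszConst_nonneg (by linarith) (by linarith)
  have hexp : 2 * (s / 2) - (N : ℝ) = s - N := by ring
  have hpow : Set.EqOn (fun y : ℝ => y ^ (Module.finrank ℝ (RN N) - 1) • y ^ (s - N))
      (fun y => y ^ (s - 1)) (Set.Ioo 0 r) := fun y hy => by
    have hy0 : (0 : ℝ) < y := hy.1
    simp only [finrank_euclideanSpace, Fintype.card_fin, smul_eq_mul]
    rw [← Real.rpow_natCast, ← Real.rpow_add hy0, Nat.cast_sub hN]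
    congr 1
    push_cast
    ring
  have hint : IntegrableOn (fun x : RN N => ‖x‖ ^ (s - N)) (Metric.ball 0 r) := by
    rw [integrableOn_fun_norm_addHaar volume (f := fun y : ℝ => y ^ (s - N)),
      integrableOn_congr_fun hpow measurableSet_Ioo,
      intervalIntegral.integrableOn_Ioo_rpow_iff hr]
    linarith
  have hval : ∫ x in Metric.ball (0 : RN N) r, ‖x‖ ^ (s - N) =
      N * volume.real (Metric.ball (0 : RN N) 1) * (r ^ s / s) := by
    have hind : ∀ x : RN N, (Metric.ball (0 : RN N) r).indicator (fun x => ‖x‖ ^ (s - N)) x =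
        (Set.Iio r).indicator (fun y : ℝ => y ^ (s - N)) ‖x‖ := fun x => by
      simp [Set.indicator]
    have hind' : ∀ y : ℝ, y ^ (Module.finrank ℝ (RN N) - 1) •
        (Set.Iio r).indicator (fun y : ℝ => y ^ (s - N)) y = (Set.Iio r).indicator
          (fun y : ℝ => y ^ (Module.finrank ℝ (RN N) - 1) • y ^ (s - N)) y := fun y => by
      simp only [Set.indicator, smul_eq_mul]; split_ifs <;> simp
    rw [← integral_indicator measurableSet_ball]
    simp_rw [hind]
    rw [integral_fun_norm_addHaar volume ((Set.Iio r).indicator fun y : ℝ => y ^ (s - N))]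
    simp_rw [hind']
    rw [setIntegral_indicator measurableSet_Iio, Set.Ioi_inter_Iio,
      setIntegral_congr_fun measurableSet_Ioo hpow, ← integral_Ioc_eq_integral_Ioo,
      ← intervalIntegral.integral_of_le hr.le, integral_rpow (Or.inl (by linarith))]
    simp [Real.zero_rpow hs.ne', mul_assoc]
  unfold rieszKernel
  rw [hexp, ← ofReal_integral_eq_lintegral_ofReal (hint.const_mul _)
    (ae_of_all _ fun x => by positivity), integral_const_mul, hval]
  congr 1
  ring

/-- `c_{N,s/2}` vanishes linearly in `s`, with slope the reciprocal of the area `N |B_1|` of the unit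
sphere. -/
theorem tendsto_rieszConst_div (hN : 1 ≤ N) :
    Tendsto (fun s : ℝ => rieszConst N (s / 2) / s *
      (N * volume.real (Metric.ball (0 : RN N) 1))) (𝓝[>] 0) (𝓝 1) := by
  have : Nonempty (Fin N) := ⟨⟨0, hN⟩⟩
  have hN0 : (0 : ℝ) < N := by exact_mod_cast hN
  set A : ℝ := N * volume.real (Metric.ball (0 : RN N) 1) with hA
  have hG : 0 < Real.Gamma ((N : ℝ) / 2) := Real.Gamma_pos_of_pos (by positivity)
  have hA' : A = 2 * Real.pi ^ ((N : ℝ) / 2) / Real.Gamma (N / 2) := by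
    rw [hA, measureReal_def, EuclideanSpace.volume_ball, Real.Gamma_add_one (by positivity)]
    simp only [ENNReal.ofReal_one, one_pow, one_mul, Fintype.card_fin]
    rw [ENNReal.toReal_ofReal (by positivity), Real.sqrt_eq_rpow, ← Real.rpow_natCast,
      ← Real.rpow_mul Real.pi_pos.le, one_div_mul_eq_div]
    field_simp
  -- The identity `Γ(s/2) s = 2 Γ(s/2 + 1)` removes the pole of `Γ` at `0`.
  have hcongr : ∀ᶠ s : ℝ in 𝓝[>] 0,
      Real.pi ^ (-((N : ℝ) / 2)) * (2 : ℝ) ^ (-s) *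
        (Real.Gamma ((N : ℝ) / 2 - s / 2) / (2 * Real.Gamma (s / 2 + 1))) * A =
      rieszConst N (s / 2) / s * A := by
    filter_upwards [self_mem_nhdsWithin] with s hs
    have hs : 0 < s := hs
    have := Real.Gamma_pos_of_pos (half_pos hs)
    unfold rieszConst
    rw [Real.Gamma_add_one (by positivity), show 2 * (s / 2) = s by ring]
    field_simp
  refine Tendsto.congr' hcongr (tendsto_nhdsWithin_of_tendsto_nhds ?_)
  have hc1 : ContinuousAt Real.Gamma ((N : ℝ) / 2 - 0 / 2) := by
    refine (Real.differentiableAt_Gamma fun n h => ?_).continuousAt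
    have : (0 : ℝ) ≤ n := n.cast_nonneg
    rw [zero_div, sub_zero] at h
    linarith
  have hc2 : ContinuousAt Real.Gamma (0 / 2 + 1) := by
    refine (Real.differentiableAt_Gamma fun n h => ?_).continuousAt
    have : (0 : ℝ) ≤ n := n.cast_nonneg
    linarith
  have hcont : ContinuousAt (fun s : ℝ => Real.pi ^ (-((N : ℝ) / 2)) * (2 : ℝ) ^ (-s) *
      (Real.Gamma ((N : ℝ) / 2 - s / 2) / (2 * Real.Gamma (s / 2 + 1))) * A) 0 := by
    have h1 : ContinuousAt (fun s : ℝ => Real.Gamma ((N : ℝ) / 2 - s / 2)) 0 :=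
      ContinuousAt.comp (f := fun s : ℝ => (N : ℝ) / 2 - s / 2) hc1 (by fun_prop)
    have h2 : ContinuousAt (fun s : ℝ => Real.Gamma (s / 2 + 1)) 0 :=
      ContinuousAt.comp (f := fun s : ℝ => s / 2 + 1) hc2 (by fun_prop)
    have h3 : ContinuousAt (fun s : ℝ => (2 : ℝ) ^ (-s)) 0 :=
      (Real.continuous_const_rpow two_ne_zero).continuousAt.comp continuous_neg.continuousAt
    refine ((continuousAt_const.mul h3).mul (h1.div (continuousAt_const.mul h2) ?_)).mul
      continuousAt_const
    simp
  have := hcont.tendsto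
  convert this using 2
  rw [hA', Real.rpow_neg Real.pi_pos.le]
  have : 0 < Real.pi ^ ((N : ℝ) / 2) := by positivity
  simp
  field_simp

/-- As `s → 0`, the mass of `K_{s/2}` concentrates at the origin: each ball carries asymptotically
mass one. -/
theorem tendsto_lintegral_ball_rieszKernel (hN : 1 ≤ N) {r : ℝ} (hr : 0 < r) :
    Tendsto (fun s : ℝ => ∫⁻ x in Metric.ball (0 : RN N) r,
      ENNReal.ofReal (rieszKernel N (s / 2) x)) (𝓝[>] 0) (𝓝 1) := by
  have hN0 : (0 : ℝ) < N := by exact_mod_cast hN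
  have hpow : Tendsto (fun s : ℝ => r ^ s) (𝓝[>] 0) (𝓝 1) := by
    have h := (Real.continuous_const_rpow hr.ne').tendsto 0
    rw [Real.rpow_zero] at h
    exact tendsto_nhdsWithin_of_tendsto_nhds h
  have h := ENNReal.tendsto_ofReal ((tendsto_rieszConst_div hN).mul hpow)
  rw [mul_one, ENNReal.ofReal_one] at h
  refine h.congr' ?_
  filter_upwards [Ioo_mem_nhdsGT hN0] with s hs
  exact (lintegral_ball_rieszKernel hN hs.1 hs.2 hr).symm

theorem tendsto_rieszConst_zero (hN : 1 ≤ N) :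
    Tendsto (fun s : ℝ => rieszConst N (s / 2)) (𝓝[>] 0) (𝓝 0) := by
  have hV : 0 < volume.real (Metric.ball (0 : RN N) 1) :=
    ENNReal.toReal_pos (Metric.measure_ball_pos volume _ one_pos).ne' measure_ball_lt_top.ne
  have hN0 : (0 : ℝ) < N := by exact_mod_cast hN
  have hid : Tendsto (fun s : ℝ => s) (𝓝[>] 0) (𝓝 0) := tendsto_id.mono_left nhdsWithin_le_nhds
  have h := ((tendsto_rieszConst_div hN).mul hid).div_const
    (N * volume.real (Metric.ball (0 : RN N) 1))
  rw [mul_zero, zero_div] at h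
  refine h.congr' ?_
  filter_upwards [self_mem_nhdsWithin] with s hs
  have hs : s ≠ 0 := ne_of_gt hs
  field_simp

/-- For small `s`, the part of `K_{s/2}` outside the unit ball is dominated by `c_{N,s/2}` times a fixed
function in `L^q`. -/
theorem exists_eLpNorm'_rieszKernel_compl_ball_le (hN : 1 ≤ N) {q : ℝ} (hq : 1 < q) :
    ∃ W : ENNReal, W ≠ ⊤ ∧ ∀ᶠ s : ℝ in 𝓝[>] 0,
      eLpNorm' ((Metric.ball (0 : RN N) 1)ᶜ.indicator
        fun x => ENNReal.ofReal (rieszKernel N (s / 2) x)) q volume ≤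
      ENNReal.ofReal (rieszConst N (s / 2)) * W := by
  have hN0 : (0 : ℝ) < N := by exact_mod_cast hN
  have hq0 : 0 < q := by linarith
  have hq1 : 0 < 1 - 1 / q := by
    rw [sub_pos, div_lt_one hq0]; exact hq
  -- `|x|^(s - N)` is in `L^q` at infinity when `s < N (1 - 1/q)`; half this threshold bounds the
  -- admissible `s`, which gives a dominating function independent of `s`.
  set σ : ℝ := N * (1 - 1 / q) / 2 with hσ
  have hσ0 : 0 < σ := by positivity
  have hσN : (N : ℝ) < (N - σ) * q := by
    have : (N - σ) * q = N + N * (q - 1) / 2 := by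
      rw [hσ]; field_simp; ring
    rw [this]
    have : 0 < N * (q - 1) / 2 := by have := sub_pos.2 hq; positivity
    linarith
  have hσN' : σ < N := by nlinarith
  set w : RN N → ENNReal := fun x => ENNReal.ofReal (((1 + ‖x‖) / 2) ^ (σ - N)) with hw
  refine ⟨eLpNorm' w q volume, ?_, ?_⟩
  · have hfin := finite_integral_one_add_norm (E := RN N) (μ := volume) (r := (N - σ) * q)
      (by simpa using hσN)
    have hwq : ∀ x, w x ^ q =
        ENNReal.ofReal (2⁻¹ ^ ((σ - N) * q)) * ENNReal.ofReal ((1 + ‖x‖) ^ (-((N - σ) * q))) := by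
      intro x
      rw [hw]
      simp only
      rw [ENNReal.ofReal_rpow_of_nonneg (by positivity) hq0.le, ← Real.rpow_mul (by positivity),
        ← ENNReal.ofReal_mul (by positivity), div_eq_mul_inv, mul_comm (1 + ‖x‖),
        Real.mul_rpow (by positivity) (by positivity)]
      congr 3
      ring
    simp only [eLpNorm', enorm_eq_self, hwq]
    rw [lintegral_const_mul _ (by fun_prop)]
    exact ENNReal.rpow_ne_top_of_nonneg (by positivity)
      (ENNReal.mul_ne_top ENNReal.ofReal_ne_top hfin.ne)
  · filter_upwards [Ioo_mem_nhdsGT hσ0] with s hs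
    have hc : 0 ≤ rieszConst N (s / 2) :=
      rieszConst_nonneg (by linarith [hs.1]) (by linarith [hs.2])
    calc _ ≤ eLpNorm' (fun x => ENNReal.ofReal (rieszConst N (s / 2)) * w x) q volume := by
          refine eLpNorm'_mono_enorm_ae hq0.le (ae_of_all _ fun x => ?_)
          simp only [enorm_eq_self]
          refine Set.indicator_apply_le' (fun hx => ?_) fun _ => zero_le
          have hx : 1 ≤ ‖x‖ := by simpa using hx
          rw [hw, ← ENNReal.ofReal_mul hc]
          refine ENNReal.ofReal_le_ofReal (mul_le_mul_of_nonneg_left ?_ hc)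
          calc ‖x‖ ^ (2 * (s / 2) - (N : ℝ)) ≤ ‖x‖ ^ (σ - N) :=
                Real.rpow_le_rpow_of_exponent_le hx (by linarith [hs.2])
            _ ≤ ((1 + ‖x‖) / 2) ^ (σ - N) :=
                Real.rpow_le_rpow_of_nonpos (by positivity) (by linarith) (by linarith)
      _ = _ := by
          simp only [eLpNorm', enorm_eq_self]
          simp_rw [ENNReal.mul_rpow_of_nonneg _ _ hq0.le]
          rw [lintegral_const_mul _ (by fun_prop), ENNReal.mul_rpow_of_nonneg _ _ (by positivity),
            ← ENNReal.rpow_mul, mul_one_div_cancel hq0.ne', ENNReal.rpow_one]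

theorem tendsto_eLpNorm'_rieszKernel_compl_ball (hN : 1 ≤ N) {q : ℝ} (hq : 1 < q) :
    Tendsto (fun s : ℝ => eLpNorm' ((Metric.ball (0 : RN N) 1)ᶜ.indicator
      fun x => ENNReal.ofReal (rieszKernel N (s / 2) x)) q volume) (𝓝[>] 0) (𝓝 0) := by
  obtain ⟨W, hW, hle⟩ := exists_eLpNorm'_rieszKernel_compl_ball_le hN hq
  have h := ENNReal.Tendsto.mul_const (ENNReal.tendsto_ofReal (tendsto_rieszConst_zero hN))
    (Or.inr hW)
  rw [ENNReal.ofReal_zero, zero_mul] at h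
  exact tendsto_of_tendsto_of_tendsto_of_le_of_le' tendsto_const_nhds h
    (Eventually.of_forall fun _ => zero_le) hle

/-! ### Upper and lower bounds for Riesz potentials -/

theorem rieszPotential_eq_lconvolution (s : ℝ) {ρ : RN N → ℝ} {g : RN N → ENNReal}
    (h : (fun x => ENNReal.ofReal (ρ x)) =ᵐ[volume] g) :
    rieszPotential N s ρ = g ⋆ₗ fun x => ENNReal.ofReal (rieszKernel N s x) := by
  ext x
  refine lintegral_congr_ae ?_
  filter_upwards [h] with y hy
  rw [← hy, mul_comm, neg_add_eq_sub]

/-- The part of the kernel in the unit ball is estimated in `L^1` against `g ∈ L^q`, the part outside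
in `L^q` against `g ∈ L^1`. -/
theorem eLpNorm'_lconvolution_rieszKernel_le {q : ℝ} (hq : 1 < q) (s : ℝ)
    {g : RN N → ENNReal} (hg : Measurable g) :
    eLpNorm' (g ⋆ₗ fun x => ENNReal.ofReal (rieszKernel N s x)) q volume ≤
      (∫⁻ x in Metric.ball (0 : RN N) 1, ENNReal.ofReal (rieszKernel N s x)) *
          eLpNorm' g q volume +
        (∫⁻ x, g x) * eLpNorm' ((Metric.ball (0 : RN N) 1)ᶜ.indicator
          fun x => ENNReal.ofReal (rieszKernel N s x)) q volume := by
  set κ : RN N → ENNReal := fun x => ENNReal.ofReal (rieszKernel N s x)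
  have hκ : Measurable κ := measurable_ofReal_rieszKernel s
  have hb : MeasurableSet (Metric.ball (0 : RN N) 1) := measurableSet_ball
  have hsplit : g ⋆ₗ κ = ((Metric.ball (0 : RN N) 1).indicator κ ⋆ₗ g) +
      (g ⋆ₗ (Metric.ball (0 : RN N) 1)ᶜ.indicator κ) := by
    rw [lconvolution_comm (f := (Metric.ball (0 : RN N) 1).indicator κ)]
    ext x
    have hn := hκ.indicator hb
    simp only [Pi.add_apply, lconvolution_def]
    rw [← lintegral_add_left (by fun_prop)]
    refine lintegral_congr fun y => ?_
    rw [← mul_add, ← Pi.add_apply, Set.indicator_self_add_compl]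
  have hn := hκ.indicator hb
  have hf := hκ.indicator hb.compl
  rw [hsplit]
  refine (eLpNorm'_add_le (Measurable.aestronglyMeasurable (by fun_prop))
    (Measurable.aestronglyMeasurable (by fun_prop)) hq.le).trans (add_le_add ?_ ?_)
  · refine (eLpNorm'_lconvolution_le hq hn hg).trans_eq ?_
    rw [lintegral_indicator hb]
  · exact eLpNorm'_lconvolution_le hq hg hf

/-- The kernel truncated to the unit ball is an approximate identity from below at each point, since
the mass of every smaller ball tends to one. -/
theorem le_liminf_lconvolution_rieszKernel_apply (hN : 1 ≤ N) {f : RN N → ENNReal}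
    (hf : Continuous f) (x : RN N) :
    f x ≤ liminf (fun s : ℝ => ((Metric.ball (0 : RN N) 1).indicator
      (fun x => ENNReal.ofReal (rieszKernel N (s / 2) x)) ⋆ₗ f) x) (𝓝[>] 0) := by
  refine le_of_forall_lt fun c hc => ?_
  obtain ⟨c', hcc', hc'⟩ := exists_between hc
  refine hcc'.trans_le ?_
  have hev : ∀ᶠ y in 𝓝 (0 : RN N), c' < f (-y + x) := by
    have : ContinuousAt (fun y => f (-y + x)) 0 := by fun_prop
    exact this.eventually (lt_mem_nhds (by simpa using hc'))
  obtain ⟨r, hr, hball⟩ := Metric.eventually_nhds_iff_ball.1 hev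
  have hr' : 0 < min r 1 := lt_min hr one_pos
  have hlim := ENNReal.Tendsto.mul_const (b := c')
    (tendsto_lintegral_ball_rieszKernel hN hr') (Or.inl one_ne_zero)
  rw [one_mul] at hlim
  rw [← hlim.liminf_eq]
  refine liminf_le_liminf (Eventually.of_forall fun s => ?_)
  rw [lconvolution_def, ← lintegral_mul_const _ (measurable_ofReal_rieszKernel _)]
  refine le_trans ?_ (setLIntegral_le_lintegral (Metric.ball (0 : RN N) (min r 1)) _)
  refine setLIntegral_mono' measurableSet_ball fun y hy => ?_
  rw [Set.indicator_of_mem (Metric.ball_subset_ball (min_le_right _ _) hy)]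
  gcongr
  exact (hball y (Metric.ball_subset_ball (min_le_left _ _) hy)).le

theorem eLpNorm'_le_liminf_lconvolution_of_continuous (hN : 1 ≤ N) {q : ℝ} (hq : 1 < q)
    {f : RN N → ENNReal} (hf : Continuous f) :
    eLpNorm' f q volume ≤ liminf (fun s : ℝ => eLpNorm' ((Metric.ball (0 : RN N) 1).indicator
      (fun x => ENNReal.ofReal (rieszKernel N (s / 2) x)) ⋆ₗ f) q volume) (𝓝[>] 0) := by
  have hq0 : 0 < q := by linarith
  have hκ (s : ℝ) := (measurable_ofReal_rieszKernel (N := N) s).indicator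
    (measurableSet_ball (x := (0 : RN N)) (ε := 1))
  have hfm := hf.measurable
  simp only [eLpNorm', enorm_eq_self]
  have hFatou : ∫⁻ x, f x ^ q ≤ liminf (fun s : ℝ => ∫⁻ x,
      ((Metric.ball (0 : RN N) 1).indicator
        (fun x => ENNReal.ofReal (rieszKernel N (s / 2) x)) ⋆ₗ f) x ^ q) (𝓝[>] 0) := by
    refine le_trans (lintegral_mono fun x => ?_) (lintegral_liminf_le fun s => ?_)
    · have := (ENNReal.orderIsoRpow q hq0).monotone
        (le_liminf_lconvolution_rieszKernel_apply hN hf x)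
      rw [OrderIso.liminf_apply] at this
      exact this
    · have := hκ (s / 2)
      fun_prop
  have := (ENNReal.orderIsoRpow (1 / q) (by positivity)).monotone hFatou
  rw [OrderIso.liminf_apply] at this
  exact this

theorem ofReal_le_ofReal_add_enorm_sub (a b : ℝ) :
    ENNReal.ofReal a ≤ ENNReal.ofReal b + ‖a - b‖ₑ := by
  rw [Real.enorm_eq_ofReal_abs]
  exact (ENNReal.ofReal_le_ofReal (by linarith [le_abs_self (a - b)])).trans
    ENNReal.ofReal_add_le

/-- The lower bound for a measurable density in `L^q`, by approximation with a continuous function `φ`: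
the error of replacing `ρ` by `φ` under the truncated kernel is at most the mass of that kernel times
`‖ρ - φ‖_q`. -/
theorem eLpNorm'_le_liminf_lconvolution_rieszKernel (hN : 1 ≤ N) {q : ℝ} (hq : 1 < q)
    {ρ : RN N → ℝ} (hρm : Measurable ρ) (hρ : MemLp ρ (ENNReal.ofReal q) volume) :
    eLpNorm' (fun x => ENNReal.ofReal (ρ x)) q volume ≤
      liminf (fun s : ℝ => eLpNorm' ((fun x => ENNReal.ofReal (ρ x)) ⋆ₗ
        fun x => ENNReal.ofReal (rieszKernel N (s / 2) x)) q volume) (𝓝[>] 0) := by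
  have hq0 : 0 < q := by linarith
  refine ENNReal.le_of_forall_pos_le_add fun ε hε _ => ?_
  have hε3 : (ε / 3 : NNReal) ≠ 0 := by positivity
  obtain ⟨φ, -, hφε, hφ, -⟩ := hρ.exists_hasCompactSupport_eLpNorm_sub_le ENNReal.ofReal_ne_top
    (ENNReal.coe_ne_zero.2 hε3)
  set g : RN N → ENNReal := fun x => ENNReal.ofReal (ρ x) with hg
  set f : RN N → ENNReal := fun x => ENNReal.ofReal (φ x) with hf
  set h : RN N → ENNReal := fun x => ‖ρ x - φ x‖ₑ with hh
  have hφm := hφ.measurable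
  have hgm : Measurable g := by fun_prop
  have hfc : Continuous f := ENNReal.continuous_ofReal.comp hφ
  have hfm : Measurable f := hfc.measurable
  have hhm : Measurable h := by fun_prop
  have hhε : eLpNorm' h q volume ≤ (ε / 3 : NNReal) := by
    rw [eLpNorm_eq_eLpNorm' (by simpa using hq0) ENNReal.ofReal_ne_top,
      ENNReal.toReal_ofReal hq0.le] at hφε
    refine le_trans (le_of_eq ?_) hφε
    simp [eLpNorm', hh]
  have hgf : g ≤ f + h := fun x => ofReal_le_ofReal_add_enorm_sub _ _
  have hfg : f ≤ g + h := fun x => by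
    simpa [hh, enorm_sub_rev (ρ x)] using ofReal_le_ofReal_add_enorm_sub (φ x) (ρ x)
  set κ : ℝ → RN N → ENNReal := fun s x => ENNReal.ofReal (rieszKernel N (s / 2) x) with hκdef
  have hκ (s : ℝ) : Measurable (κ s) := measurable_ofReal_rieszKernel _
  set b : ℝ → RN N → ENNReal := fun s => (Metric.ball (0 : RN N) 1).indicator (κ s) with hb
  have hbm (s : ℝ) : Measurable (b s) := (hκ s).indicator measurableSet_ball
  -- The mass of the truncated kernel tends to `1`; the bound `2` suffices, and then the errors
  -- `2ε/3` and `ε/3` below add up to `ε`.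
  have hmass : ∀ᶠ s : ℝ in 𝓝[>] 0, ∫⁻ x, b s x ≤ 2 := by
    have := (tendsto_lintegral_ball_rieszKernel hN one_pos).eventually
      (ge_mem_nhds ENNReal.one_lt_two)
    filter_upwards [this] with s hs
    rwa [hb, lintegral_indicator measurableSet_ball]
  have hbf : ∀ᶠ s : ℝ in 𝓝[>] 0,
      eLpNorm' (b s ⋆ₗ f) q volume ≤ eLpNorm' (g ⋆ₗ κ s) q volume + 2 * (ε / 3 : NNReal) := by
    filter_upwards [hmass] with s hs
    calc eLpNorm' (b s ⋆ₗ f) q volume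
        ≤ eLpNorm' ((g ⋆ₗ κ s) + (b s ⋆ₗ h)) q volume := by
          refine eLpNorm'_mono_enorm_ae hq0.le (ae_of_all _ fun x => ?_)
          simp only [enorm_eq_self, Pi.add_apply]
          rw [lconvolution_comm (f := g), lconvolution_def, lconvolution_def, lconvolution_def]
          have := hbm s
          rw [← lintegral_add_right _ (by fun_prop)]
          refine lintegral_mono fun y => ?_
          calc b s y * f (-y + x) ≤ b s y * (g (-y + x) + h (-y + x)) := by
                gcongr; exact hfg _
            _ ≤ _ := by
                rw [mul_add]
                gcongr
                exact Set.indicator_le_self _ _ _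
      _ ≤ eLpNorm' (g ⋆ₗ κ s) q volume + eLpNorm' (b s ⋆ₗ h) q volume := by
          have := hbm s
          have := hκ s
          exact eLpNorm'_add_le (Measurable.aestronglyMeasurable (by fun_prop))
            (Measurable.aestronglyMeasurable (by fun_prop)) hq.le
      _ ≤ _ := by
          gcongr
          exact (eLpNorm'_lconvolution_le hq (hbm s) hhm).trans (mul_le_mul' hs hhε)
  calc eLpNorm' g q volume ≤ eLpNorm' (f + h) q volume :=
        eLpNorm'_mono_enorm_ae hq0.le (ae_of_all _ fun x => by simpa using hgf x)
    _ ≤ eLpNorm' f q volume + eLpNorm' h q volume :=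
        eLpNorm'_add_le hfm.aestronglyMeasurable hhm.aestronglyMeasurable hq.le
    _ ≤ liminf (fun s : ℝ => eLpNorm' (g ⋆ₗ κ s) q volume + 2 * (ε / 3 : NNReal)) (𝓝[>] 0) +
          (ε / 3 : NNReal) := by
        gcongr
        exact (eLpNorm'_le_liminf_lconvolution_of_continuous hN hq hfc).trans
          (liminf_le_liminf hbf)
    _ = liminf (fun s : ℝ => eLpNorm' (g ⋆ₗ κ s) q volume) (𝓝[>] 0) + 2 * (ε / 3 : NNReal) +
          (ε / 3 : NNReal) := by
        rw [liminf_add_const _ _ _ (by isBoundedDefault) (by isBoundedDefault)]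
    _ = _ := by
        rw [add_assoc]
        congr 1
        norm_cast
        ring

theorem eLpNorm'_rieszPotential_le {q : ℝ} (hq : 1 < q) (s : ℝ) {ρ : RN N → ℝ}
    (hρ : AEMeasurable ρ volume) :
    eLpNorm' (rieszPotential N s ρ) q volume ≤
      (∫⁻ x in Metric.ball (0 : RN N) 1, ENNReal.ofReal (rieszKernel N s x)) *
          eLpNorm' (fun x => ENNReal.ofReal (ρ x)) q volume +
        (∫⁻ x, ENNReal.ofReal (ρ x)) * eLpNorm' ((Metric.ball (0 : RN N) 1)ᶜ.indicator
          fun x => ENNReal.ofReal (rieszKernel N s x)) q volume := by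
  have hae := hρ.ennreal_ofReal.ae_eq_mk
  rw [rieszPotential_eq_lconvolution s hae, eLpNorm'_congr_ae hae, lintegral_congr_ae hae]
  exact eLpNorm'_lconvolution_rieszKernel_le hq s hρ.ennreal_ofReal.measurable_mk

theorem eLpNorm'_le_liminf_rieszPotential (hN : 1 ≤ N) {q : ℝ} (hq : 1 < q) {ρ : RN N → ℝ}
    (hρ : MemLp ρ (ENNReal.ofReal q) volume) :
    eLpNorm' (fun x => ENNReal.ofReal (ρ x)) q volume ≤
      liminf (fun s : ℝ => eLpNorm' (rieszPotential N (s / 2) ρ) q volume) (𝓝[>] 0) := by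
  have hm := hρ.aestronglyMeasurable.aemeasurable
  have hae : (fun x => ENNReal.ofReal (ρ x)) =ᵐ[volume] fun x => ENNReal.ofReal (hm.mk ρ x) :=
    hm.ae_eq_mk.fun_comp ENNReal.ofReal
  simp_rw [rieszPotential_eq_lconvolution _ hae]
  rw [eLpNorm'_congr_ae hae]
  exact eLpNorm'_le_liminf_lconvolution_rieszKernel hN hq hm.measurable_mk
    ((memLp_congr_ae hm.ae_eq_mk).1 hρ)

/-! ### Limits of the two terms of the energy -/

theorem lintegral_rpow_eq_eLpNorm'_rpow {α : Type*} [MeasurableSpace α] {μ : Measure α} {q : ℝ}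
    (hq : 0 < q) (f : α → ENNReal) : ∫⁻ x, f x ^ q ∂μ = eLpNorm' f q μ ^ q := by
  simp only [eLpNorm', enorm_eq_self]
  rw [← ENNReal.rpow_mul, one_div_mul_cancel hq.ne', ENNReal.rpow_one]

theorem powerIntegral_le_lintegral_enorm {r : ℝ} (hr : 0 < r) (ρ : RN N → ℝ) :
    powerIntegral N r ρ ≤ ∫⁻ x, ‖ρ x‖ₑ ^ r :=
  lintegral_mono fun x => ENNReal.rpow_le_rpow (by
    rw [Real.enorm_eq_ofReal_abs]; exact ENNReal.ofReal_le_ofReal (le_abs_self _)) hr.le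

theorem powerIntegral_ne_top {r : ℝ} (hr : 0 < r) {ρ : RN N → ℝ}
    (hρ : MemLp ρ (ENNReal.ofReal r) volume) : powerIntegral N r ρ ≠ ⊤ := by
  have h := lintegral_rpow_enorm_lt_top_of_eLpNorm_lt_top (by simpa using hr)
    ENNReal.ofReal_ne_top hρ.eLpNorm_lt_top
  rw [ENNReal.toReal_ofReal hr.le] at h
  exact ((powerIntegral_le_lintegral_enorm hr ρ).trans_lt h).ne

theorem memLp_of_one_le_of_le {α : Type*} [MeasurableSpace α] {μ : Measure α} {f : α → ℝ}
    {q m : ℝ} (hq : 1 ≤ q) (hqm : q ≤ m) (h1 : MemLp f 1 μ) (hm : MemLp f (ENNReal.ofReal m) μ) :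
    MemLp f (ENNReal.ofReal q) μ := by
  have hq0 : 0 < q := by linarith
  have hm0 : 0 < m := by linarith
  refine ⟨h1.aestronglyMeasurable, ?_⟩
  rw [eLpNorm_lt_top_iff_lintegral_rpow_enorm_lt_top (by simpa using hq0) ENNReal.ofReal_ne_top,
    ENNReal.toReal_ofReal hq0.le]
  have h := lintegral_rpow_enorm_lt_top_of_eLpNorm_lt_top (by simpa using hm0)
    ENNReal.ofReal_ne_top hm.eLpNorm_lt_top
  rw [ENNReal.toReal_ofReal hm0.le] at h
  have h' := h1.eLpNorm_lt_top
  rw [eLpNorm_one_eq_lintegral_enorm] at h'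
  calc ∫⁻ x, ‖f x‖ₑ ^ q ∂μ ≤ ∫⁻ x, ‖f x‖ₑ + ‖f x‖ₑ ^ m ∂μ := by
        refine lintegral_mono fun x => ?_
        rcases le_total ‖f x‖ₑ 1 with hx | hx
        · refine le_add_right ?_
          simpa using ENNReal.rpow_le_rpow_of_exponent_ge hx hq
        · exact le_add_left (ENNReal.rpow_le_rpow_of_exponent_le hx hqm)
    _ = ∫⁻ x, ‖f x‖ₑ ∂μ + ∫⁻ x, ‖f x‖ₑ ^ m ∂μ :=
        lintegral_add_left' h1.aestronglyMeasurable.enorm _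
    _ < ⊤ := ENNReal.add_lt_top.2 ⟨h', h⟩

/-- Strong `L^q` convergence gives almost everywhere convergence along a subsequence of one that
realizes the lower limit; Fatou's lemma applies along it. -/
theorem powerIntegral_le_liminf {q r : ℝ} (hq : 0 < q) {u : ℕ → RN N → ℝ}
    {ρ : RN N → ℝ} (hu : ∀ k, AEStronglyMeasurable (u k) volume)
    (hρ : AEStronglyMeasurable ρ volume) (hconv : StrongLpConv N q u ρ) :
    powerIntegral N r ρ ≤ liminf (fun k => powerIntegral N r (u k)) atTop := by
  obtain ⟨φ, hφlim, hφ⟩ :=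
    exists_seq_tendsto_liminf (f := atTop) (u := fun k => powerIntegral N r (u k))
  have hmeas : TendstoInMeasure volume (fun k => u (φ k)) atTop ρ :=
    tendstoInMeasure_of_tendsto_eLpNorm (p := ENNReal.ofReal q) (by simpa using hq)
      (fun k => hu _) hρ (hconv.comp hφ)
  obtain ⟨ψ, hψ, hae⟩ := hmeas.exists_seq_tendsto_ae
  rw [← (hφlim.comp hψ.tendsto_atTop).liminf_eq]
  refine le_trans (le_of_eq (lintegral_congr_ae ?_))
    (lintegral_liminf_le' fun k => ((hu _).aemeasurable.ennreal_ofReal.pow_const r))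
  filter_upwards [hae] with x hx
  exact (((ENNReal.continuous_rpow_const.comp ENNReal.continuous_ofReal).tendsto _).comp
    hx).liminf_eq.symm

theorem powerIntegral_le_liminf_rieszPotential (hN : 1 ≤ N) {q : ℝ} (hq : 1 < q) {ρ : RN N → ℝ}
    (hρ : MemLp ρ (ENNReal.ofReal q) volume) {s : ℕ → ℝ} (hs : Tendsto s atTop (𝓝[>] 0)) :
    powerIntegral N q ρ ≤
      liminf (fun k => ∫⁻ x, rieszPotential N (s k / 2) ρ x ^ q) atTop := by
  have hq0 : 0 < q := by linarith
  unfold powerIntegral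
  simp_rw [lintegral_rpow_eq_eLpNorm'_rpow hq0]
  have h := (ENNReal.orderIsoRpow q hq0).monotone
    ((eLpNorm'_le_liminf_rieszPotential hN hq hρ).trans hs.liminf_le_liminf_comp)
  rw [OrderIso.liminf_apply] at h
  exact h

/-- The upper bound for the interaction term along convergent densities of fixed mass, as a convergent
majorant: `‖K_{s/2} ∗ u_k‖_q ≤ a_k (‖ρ‖_q + ‖u_k - ρ‖_q) + M b_k`, where `a_k → 1` is the mass of the
kernel in the unit ball and `b_k → 0` its `L^q` norm outside. -/
theorem exists_tendsto_lintegral_rieszPotential_le (hN : 1 ≤ N) {q M : ℝ} (hq : 1 < q)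
    {ρ : RN N → ℝ} (hρ : MemLp ρ (ENNReal.ofReal q) volume) {u : ℕ → RN N → ℝ}
    (hu : ∀ k, AEMeasurable (u k) volume)
    (huM : ∀ k, ∫⁻ x, ENNReal.ofReal (u k x) = ENNReal.ofReal M)
    (hconv : StrongLpConv N q u ρ) {s : ℕ → ℝ} (hs : Tendsto s atTop (𝓝[>] 0)) :
    ∃ t : ℕ → ENNReal, Tendsto t atTop (𝓝 (powerIntegral N q ρ)) ∧
      ∀ k, ∫⁻ x, rieszPotential N (s k / 2) (u k) x ^ q ≤ t k := by
  have hq0 : 0 < q := by linarith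
  set G : ENNReal := eLpNorm' (fun x => ENNReal.ofReal (ρ x)) q volume with hG
  have hGq : powerIntegral N q ρ = G ^ q := lintegral_rpow_eq_eLpNorm'_rpow hq0 _
  have hGtop : G ≠ ⊤ := fun h => powerIntegral_ne_top hq0 hρ (by simp [hGq, h, hq0])
  set δ : ℕ → ENNReal := fun k => eLpNorm (fun x => u k x - ρ x) (ENNReal.ofReal q) volume
  set a : ℝ → ENNReal := fun s => ∫⁻ x in Metric.ball (0 : RN N) 1,
    ENNReal.ofReal (rieszKernel N (s / 2) x)
  set b : ℝ → ENNReal := fun s => eLpNorm' ((Metric.ball (0 : RN N) 1)ᶜ.indicator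
    fun x => ENNReal.ofReal (rieszKernel N (s / 2) x)) q volume
  have hnorm : ∀ k, eLpNorm' (fun x => ENNReal.ofReal (u k x)) q volume ≤ G + δ k := fun k => by
    have hδ : eLpNorm' (fun x => ‖u k x - ρ x‖ₑ) q volume = δ k := by
      simp only [δ]
      rw [eLpNorm_eq_eLpNorm' (by simpa using hq0) ENNReal.ofReal_ne_top,
        ENNReal.toReal_ofReal hq0.le]
      simp [eLpNorm']
    rw [← hδ]
    refine le_trans (eLpNorm'_mono_enorm_ae hq0.le (ae_of_all _ fun x => ?_)) (eLpNorm'_add_le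
      hρ.aestronglyMeasurable.aemeasurable.ennreal_ofReal.aestronglyMeasurable
      ((hu k).sub hρ.aestronglyMeasurable.aemeasurable).enorm.aestronglyMeasurable hq.le)
    simpa using ofReal_le_ofReal_add_enorm_sub (u k x) (ρ x)
  have ha : Tendsto (fun k => a (s k)) atTop (𝓝 1) :=
    (tendsto_lintegral_ball_rieszKernel hN one_pos).comp hs
  have hb : Tendsto (fun k => b (s k)) atTop (𝓝 0) :=
    (tendsto_eLpNorm'_rieszKernel_compl_ball hN hq).comp hs
  have hGδ : Tendsto (fun k => G + δ k) atTop (𝓝 G) := by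
    simpa using tendsto_const_nhds.add hconv
  have hlim := (ENNReal.Tendsto.mul ha (Or.inl one_ne_zero) hGδ
    (Or.inr ENNReal.one_ne_top)).add (ENNReal.Tendsto.const_mul (a := ENNReal.ofReal M) hb
      (Or.inr ENNReal.ofReal_ne_top))
  rw [one_mul, mul_zero, add_zero] at hlim
  refine ⟨_, hGq ▸ (ENNReal.continuous_rpow_const (y := q)).continuousAt.tendsto.comp hlim,
    fun k => ?_⟩
  rw [lintegral_rpow_eq_eLpNorm'_rpow hq0]
  refine ENNReal.rpow_le_rpow ((eLpNorm'_rieszPotential_le hq _ (hu k)).trans ?_) hq0.le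
  rw [huM]
  exact add_le_add (mul_le_mul' le_rfl (hnorm k)) le_rfl

end Riesz

/-! ### Limits of differences, and the conclusion -/

theorem liminf_coe_ennreal (a : ℕ → ENNReal) :
    liminf (fun k => (a k : EReal)) atTop = ((liminf a atTop : ENNReal) : EReal) :=
  (Monotone.map_liminf_of_continuousAt EReal.coe_ennreal_strictMono.monotone a
    continuous_coe_ennreal_ereal.continuousAt).symm

theorem coe_sub_le_liminf {a b t : ℕ → ENNReal} {A B : ENNReal} (ha : A ≤ liminf a atTop)
    (ht : Tendsto t atTop (𝓝 B)) (hbt : ∀ k, b k ≤ t k) :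
    (A : EReal) - B ≤ liminf (fun k => (a k : EReal) - b k) atTop := by
  have ht' : liminf (fun k => -(t k : EReal)) atTop = -(B : EReal) :=
    ((continuous_neg.tendsto _).comp (EReal.tendsto_coe_ennreal.2 ht)).liminf_eq
  calc (A : EReal) - B ≤ liminf (fun k => (a k : EReal)) atTop +
        liminf (fun k => -(t k : EReal)) atTop := by
        rw [ht', liminf_coe_ennreal, sub_eq_add_neg]
        gcongr
        exact EReal.coe_ennreal_le_coe_ennreal_iff.2 ha
    _ ≤ liminf (fun k => (a k : EReal) + -(t k : EReal)) atTop := EReal.le_liminf_add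
    _ ≤ _ := by
        refine liminf_le_liminf (Eventually.of_forall fun k => ?_)
        rw [sub_eq_add_neg]
        gcongr
        exact EReal.neg_le_neg_iff.2 (EReal.coe_ennreal_le_coe_ennreal_iff.2 (hbt k))

theorem limsup_coe_sub_le {b : ℕ → ENNReal} {A B : ENNReal} (hA : A ≠ ⊤)
    (hb : B ≤ liminf b atTop) :
    limsup (fun k => (A : EReal) - b k) atTop ≤ (A : EReal) - B := by
  have hA' : limsup (fun _ : ℕ => (A : EReal)) atTop = A := limsup_const _
  calc _ = limsup ((fun _ => (A : EReal)) + fun k => -(b k : EReal)) atTop := rfl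
    _ ≤ limsup (fun _ : ℕ => (A : EReal)) atTop + limsup (-fun k => (b k : EReal)) atTop :=
        EReal.limsup_add_le (Or.inl (by simp [hA'])) (Or.inl (by simp [hA', hA]))
    _ ≤ _ := by
        rw [hA', EReal.limsup_neg, liminf_coe_ennreal, sub_eq_add_neg]
        gcongr
        exact EReal.neg_le_neg_iff.2 (EReal.coe_ennreal_le_coe_ennreal_iff.2 hb)

/-- For `m > p'`, the functionals `F_{s,p}` `Γ`-converge to `F_0` on `𝒴_M` as `s → 0`, with respect
to strong `L^{p'}` convergence: this holds along every sequence of admissible `s` tending to `0`. -/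
theorem mainTheorem3 (N : ℕ) (hN : 1 ≤ N) (p m χ M : ℝ) (hp : 1 < p) (hm : p.conjExponent < m)
    (hχ : 0 < χ) (hM : 0 < M) (s : ℕ → ℝ) (hs : ∀ k, 0 < s k ∧ s k * p < N)
    (hs0 : Tendsto s atTop (𝓝 0)) :
    GammaConvergesOn (StrongLpConv N p.conjExponent) (densityClass N m M)
      (fun k => freeEnergy N p m χ (s k)) (limitEnergy N p m χ) := by
  have hq : 1 < p.conjExponent := (Real.HolderConjugate.conjExponent hp).symm.lt
  unfold freeEnergy limitEnergy
  set q : ℝ := p.conjExponent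
  have hq0 : 0 < q := by linarith
  have hm0 : 0 < m := by linarith
  have hs' : Tendsto s atTop (𝓝[>] 0) :=
    tendsto_nhdsWithin_iff.2 ⟨hs0, Eventually.of_forall fun k => (hs k).1⟩
  -- The recovery sequence is constant.
  refine ⟨fun ρ hρ u hu hconv => ?_, fun ρ hρ => ⟨fun _ => ρ, fun _ => hρ, ?_, ?_⟩⟩
  · have hρq := memLp_of_one_le_of_le hq.le hm.le hρ.1 hρ.2.1
    obtain ⟨t, ht, hle⟩ := exists_tendsto_lintegral_rieszPotential_le (M := M) hN hq hρq
      (fun k => (hu k).1.aestronglyMeasurable.aemeasurable) (fun k => by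
        rw [← ofReal_integral_eq_lintegral_ofReal (memLp_one_iff_integrable.1 (hu k).1)
          (hu k).2.2.1, (hu k).2.2.2.2.2]) hconv hs'
    refine coe_sub_le_liminf ?_ (ENNReal.Tendsto.const_mul ht (Or.inr ENNReal.ofReal_ne_top))
      fun k => mul_le_mul_right (hle k) _
    rw [ENNReal.liminf_const_mul_of_ne_top ENNReal.ofReal_ne_top]
    gcongr
    exact powerIntegral_le_liminf hq0 (fun k => (hu k).1.aestronglyMeasurable)
      hρ.1.aestronglyMeasurable hconv
  · simp [StrongLpConv]
  · have hρq := memLp_of_one_le_of_le hq.le hm.le hρ.1 hρ.2.1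
    refine limsup_coe_sub_le
      (ENNReal.mul_ne_top ENNReal.ofReal_ne_top (powerIntegral_ne_top hm0 hρ.2.1)) ?_
    rw [ENNReal.liminf_const_mul_of_ne_top ENNReal.ofReal_ne_top]
    gcongr
    exact powerIntegral_le_liminf_rieszPotential hN hq hρq hs'
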